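/- Let $\mathbb F_q$ be a finite field with $q$ elements and $\overline{\mathbb F}_q$ an algebraic closure. Let $\mathbb G_a$ and $\mathbb G_m$ be the additive and multiplicative groups over $\mathbb F_q$, so that $\mathbb G_a(\overline{\mathbb F}_q)=\overline{\mathbb F}_q$ and $\mathbb G_m(\overline{\mathbb F}_q)=\overline{\mathbb F}_q^{\,\times}$, with Frobenius $x\mapsto x^q$. Let $\mathcal P$ be the set of all partitions of non-negative integers; for $\lambda\in\mathcal P$ let $|\lambda|$ be the integer that $\lambda$ partitions. For $X=\mathbb G_a$ or $X=\mathbb G_m$, a (partition) coloring of $X/\mathbb F_q$ is a map $\Lambda: X(\overline{\mathbb F}_q)\to\mathcal P$ that takes the value $0$ (the empty partition) at all but finitely many points and satisfies $\Lambda(x^q)=\Lambda(x)$ for all $x$; its degree is $|\Lambda|=\sum_{x}|\Lambda(x)|$. Put $$Z_C(X,T)=\sum_{\Lambda}T^{|\Lambda|}\in\mathbb Z[[T]],$$ the sum being over all colorings of $X/\mathbb F_q$. (1) Let $C_n$ be the number of conjugacy classes in $\mathrm{GL}_n(\mathbb F_q)$, $n\ge 0$ (so $C_0=1$). The sum $Z_C(\mathbb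 G_m,T)$ converges coefficientwise, and, as formal power series, $$Z_C(\mathbb G_m,T)=\sum_{n\ge 0}C_nT^n=\prod_{n\ge1}\frac{1-T^n}{1-qT^n}.$$ (2) Let $C'_n$ be the number of conjugacy classes in $M_n(\mathbb F_q)$, that is, the number of orbits of $\mathrm{GL}_n(\mathbb F_q)$ acting by conjugation on the $n\times n$ matrices over $\mathbb F_q$, $n\ge 0$ (so $C'_0=1$). The sum $Z_C(\mathbb G_a,T)$ converges coefficientwise, and, as formal power series, $$Z_C(\mathbb G_a,T)=\sum_{n\ge 0}C'_nT^n=\prod_{n\ge1}(1-qT^n)^{-1}.$$ -/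

import Mathlib

open PowerSeries
open scoped PowerSeries.WithPiTopology

/-- A set of colors with a degree function: finitely many colors of each degree, and a unique
color of degree zero. -/
structure ColorSet where
  Color : Type
  zero : Color
  deg : Color → ℕ
  finite_deg : ∀ n : ℕ, {c | deg c = n}.Finite
  deg_eq_zero_iff : ∀ c : Color, deg c = 0 ↔ c = zero

/-- The colors are the partitions of non-negative integers, and the degree of a partition is the
integer that it partitions. -/
def partitionColors : ColorSet where
  Color := Σ n : ℕ, n.Partition
  zero := ⟨0, default⟩
  deg := Sigma.fst
  finite_deg n := by
    refine (Set.finite_range (fun p : n.Partition => (⟨n, p⟩ : Σ n : ℕ, n.Partition))).subset ?_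
    rintro ⟨m, p⟩ rfl
    exact ⟨p, rfl⟩
  deg_eq_zero_iff := by
    rintro ⟨n, p⟩
    constructor
    · rintro rfl
      rw [Subsingleton.elim p default]
    · intro h
      rw [h]

/-- Let `P` be the set of geometric points of a variety `X` over a finite field with `q` elements,
and let `F : P → P` be the action of the Frobenius `x ↦ x ^ q`. A coloring of `X` over the finite
field is a map from `P` to the colors that is nonzero at only finitely many points (so it has
finite degree) and is fixed by Frobenius. -/
structure Coloring (C : ColorSet) {P : Type*} (F : P → P) where
  color : P → C.Color
  finite_support : {x | color x ≠ C.zero}.Finite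
  frob_fixed : ∀ x, color (F x) = color x

/-- The degree of a coloring: the sum over all geometric points of the degree of the color. -/
noncomputable def Coloring.degree {C : ColorSet} {P : Type*} {F : P → P}
    (L : Coloring C F) : ℕ :=
  ∑ᶠ x : P, C.deg (L.color x)

/-- `Z` is the coloring zeta function with trivial weight `1`, that is, the sum of
`T ^ (degree of L)` over all colorings `L`, as a formal power series: the sum converges
coefficientwise to `Z`. -/
def IsColoringZeta (C : ColorSet) {P : Type*} (F : P → P) (Z : ℤ⟦X⟧) : Prop :=
  HasSum (fun L : Coloring C F => (X : ℤ⟦X⟧) ^ L.degree) Z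

/-- The Frobenius over `k` on the geometric points of the additive group. -/
noncomputable def frobGa (k K : Type*) [Field k] [Field K] : K → K :=
  fun x => x ^ Nat.card k

/-- The Frobenius over `k` on the geometric points of the multiplicative group. -/
noncomputable def frobGm (k K : Type*) [Field k] [Field K] : Kˣ → Kˣ :=
  fun x => x ^ Nat.card k

/-- The generating function of the number of conjugacy classes in the groups `GL_n(k)`. -/
noncomputable def conjGenGL (k : Type*) [Field k] : ℤ⟦X⟧ :=
  PowerSeries.mk fun n => (Nat.card (ConjClasses (Matrix.GeneralLinearGroup (Fin n) k)) : ℤ)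

/-- The generating function of the number of conjugacy classes in `M_n(k)`, where two matrices are
conjugate if an invertible matrix conjugates one to the other. -/
noncomputable def conjGenM (k : Type*) [Field k] : ℤ⟦X⟧ :=
  PowerSeries.mk fun n => (Nat.card (ConjClasses (Matrix (Fin n) (Fin n) k)) : ℤ)

/-- The formal inverse of a power series with constant coefficient `1`. -/
noncomputable def seriesInv (f : ℤ⟦X⟧) : ℤ⟦X⟧ := PowerSeries.invOfUnit f 1

/-! All counts pass through one kind of object: finite multisets of pairs (p, e) with p a monic
irreducible polynomial over k coprime to a, e ≥ 1, and weight the sum of e · deg p. Take a = 1 for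
the additive group and M_n, a = X for the multiplicative group and GL_n.

Colorings: over a finite field the Frobenius orbits of geometric points are the fibres of x ↦
minimal polynomial, and the orbit of p has deg p points. A coloring is thus a partition attached to
each p, almost all empty; listing the parts e at p gives the multiset, and degree becomes weight
(`bijective_coloringOfPairs`, `degree_coloringOfPairs`).

Conjugacy classes: a matrix is a k[X]-module structure on k^n, up to isomorphism a product of
modules k[X]/(p^e) for a unique multiset of pairs of weight n. Invertibility says that X acts
injectively, i.e. that no p is X (`exists_hasPrimaryType`, `HasPrimaryType.unique`).

Products: sort the pairs by e instead of p. By unique factorization the p's occurring with a given e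
amount to one monic polynomial coprime to a. With N(j) such polynomials of degree j, the generating
series is ∏_i ∑_j N(j) T^(ij). Here N(j) is q^j for a = 1, and q^j - q^(j-1) (j ≥ 1) for a = X, so
the factors are 1/(1 - qT^i) and (1 - T^i)/(1 - qT^i) (`card_pairWeight_eq`, `hasProd_pairCount`).
-/

/-! ### Counting series and single factors of the products -/

theorem hasSum_X_pow_of_card {α : Type*} (d : α → ℕ) (c : ℕ → ℕ)
    (hfin : ∀ n, Finite {x // d x = n}) (hc : ∀ n, Nat.card {x // d x = n} = c n) :
    HasSum (fun x => (X : ℤ⟦X⟧) ^ d x) (PowerSeries.mk fun n => (c n : ℤ)) := by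
  rw [PowerSeries.WithPiTopology.hasSum_iff_hasSum_coeff]
  intro n
  have hs : {x | d x = n}.Finite := hfin n
  have h : ∀ x ∉ hs.toFinset, coeff n ((X : ℤ⟦X⟧) ^ d x) = 0 := by
    intro x hx
    rw [coeff_X_pow, if_neg]
    intro h
    exact hx (by simp [h])
  have key := hasSum_sum_of_ne_finset_zero h (L := .unconditional α)
  suffices hv : coeff n (PowerSeries.mk fun n => (c n : ℤ)) =
      ∑ b ∈ hs.toFinset, coeff n ((X : ℤ⟦X⟧) ^ d b) by
    rw [hv]
    exact key
  rw [coeff_mk, ← hc n, Finset.sum_congr rfl (g := fun _ => (1 : ℤ))]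
  · have : Nat.card {x // d x = n} = hs.toFinset.card := Nat.card_eq_card_finite_toFinset hs
    rw [this]
    simp
  · intro x hx
    rw [coeff_X_pow, if_pos]
    simpa [eq_comm] using hx

/-- The series has the shape of a factor in `Nat.Partition.hasProd_genFun`; the separate 1 is its j
= 0 term, whence `hN`. -/
theorem coeff_one_add_tsum {R : Type*} [CommRing R] [TopologicalSpace R] [T2Space R]
    (N : ℕ → R) (hN : N 0 = 1) (i n : ℕ) (hi : i ≠ 0) :
    coeff n (1 + ∑' j, N (j + 1) • (X : R⟦X⟧) ^ (i * (j + 1))) =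
      if i ∣ n then N (n / i) else 0 := by
  have hs := Nat.Partition.summable_genFun_term' (fun _ j => N j) hi
  rw [map_add, hs.map_tsum _ (WithPiTopology.continuous_coeff R n)]
  rcases Nat.eq_zero_or_pos n with rfl | hn
  · simp [coeff_X_pow, hN, hi]
  · rw [coeff_one, if_neg hn.ne', zero_add]
    split_ifs with h
    · obtain ⟨j, rfl⟩ := h
      have hj : j ≠ 0 := by rintro rfl; simp at hn
      obtain ⟨j, rfl⟩ := Nat.exists_eq_succ_of_ne_zero hj
      rw [tsum_eq_single j]
      · rw [Nat.mul_div_cancel_left _ (Nat.pos_of_ne_zero hi)]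
        simp [coeff_X_pow]
      · intro b hb
        have : ¬ (j = b) := fun h => hb h.symm
        simp [coeff_X_pow, hi, this]
    · rw [tsum_eq_single 0, map_smul, coeff_X_pow, if_neg, smul_zero]
      · rintro rfl; exact h ⟨_, rfl⟩
      · intro b _
        rw [map_smul, coeff_X_pow, if_neg, smul_zero]
        rintro rfl; exact h ⟨_, rfl⟩

theorem mul_seriesInv (f : ℤ⟦X⟧) (hf : constantCoeff f = 1) : f * seriesInv f = 1 :=
  PowerSeries.mul_invOfUnit f 1 (by simpa using hf)

/-- Multiplying ∑ N(j) T^(ij) by 1 - qT^i replaces N(j) by N(j) - q N(j-1). Degree 0 is split off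
because truncated subtraction would give the wrong value there. -/
theorem one_add_tsum_eq_mul {R : Type*} [CommRing R] [TopologicalSpace R] [T2Space R]
    (N : ℕ → R) (hN : N 0 = 1) (q : R) (i : ℕ) (hi : i ≠ 0) (g h : R⟦X⟧)
    (hh : (1 - PowerSeries.C q * X ^ i) * h = 1) (hg : ∀ n, coeff n g = if i ∣ n then
      (if n = 0 then 1 else N (n / i) - q * N (n / i - 1)) else 0) :
    1 + ∑' j, N (j + 1) • (X : R⟦X⟧) ^ (i * (j + 1)) =
      g * h := by
  have h2 : (1 + ∑' j, N (j + 1) • (X : R⟦X⟧) ^ (i * (j + 1))) *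
      (1 - PowerSeries.C q * X ^ i) = g := by
    ext n
    rw [mul_sub, mul_one, map_sub, hg, mul_left_comm, coeff_C_mul, coeff_mul_X_pow',
      coeff_one_add_tsum N hN i n hi]
    rcases Nat.eq_zero_or_pos n with rfl | hn
    · simp [hi, hN]
    · rw [if_neg hn.ne']
      by_cases h : i ∣ n
      · obtain ⟨j, rfl⟩ := h
        have hj : j ≠ 0 := by rintro rfl; simp at hn
        obtain ⟨j, rfl⟩ := Nat.exists_eq_succ_of_ne_zero hj
        have hi' := Nat.pos_of_ne_zero hi
        have e : i * j.succ - i = i * j := by rw [Nat.mul_succ, Nat.add_sub_cancel]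
        rw [if_pos (Nat.le_mul_of_pos_right i j.succ_pos), e, coeff_one_add_tsum N hN i _ hi]
        simp [Nat.mul_div_cancel_left _ hi']
      · rw [if_neg h, if_neg h]
        split_ifs with h3
        · rw [coeff_one_add_tsum N hN i _ hi, if_neg]
          · simp
          · intro h4
            exact h ((Nat.dvd_sub_iff_left h3 dvd_rfl).1 h4)
        · simp
  rw [← h2, mul_assoc, hh, mul_one]

theorem hasProd_pnat_of_nat {f : ℕ → ℤ⟦X⟧} {g : ℤ⟦X⟧} (h : HasProd (fun i => f (i + 1)) g) :
    HasProd (fun n : ℕ+ => f n) g := by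
  rw [← Equiv.pnatEquivNat.symm.hasProd_iff]
  simpa [Function.comp_def] using h

/-! ### Multisets of pairs, sorted by second component -/

/-- The weight of a multiset of pairs `(x, e)`, where `x` has degree `d x`: the sum of `e * d x`. -/
def pairWeight {α : Type*} (d : α → ℕ) (m : Multiset (α × ℕ+)) : ℕ :=
  (m.map fun y => (y.2 : ℕ) * d y.1).sum

/-- The first components of the pairs in a multiset that have second component `e`. -/
def pairSlice {α : Type*} (e : ℕ) (m : Multiset (α × ℕ+)) : Multiset α :=
  (m.filter fun y => (y.2 : ℕ) = e).map Prod.fst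

section
variable {α : Type*} (d : α → ℕ)

theorem pairWeight_add (m m' : Multiset (α × ℕ+)) :
    pairWeight d (m + m') = pairWeight d m + pairWeight d m' := by
  simp [pairWeight]

theorem pairSlice_add (e : ℕ) (m m' : Multiset (α × ℕ+)) :
    pairSlice e (m + m') = pairSlice e m + pairSlice e m' := by
  simp [pairSlice]

theorem count_pairSlice [DecidableEq α] (e : ℕ+) (m : Multiset (α × ℕ+)) (x : α) :
    (pairSlice e m).count x = m.count (x, e) := by
  induction m using Multiset.induction with
  | empty => simp [pairSlice]
  | cons y m ih =>
    rw [← Multiset.singleton_add, pairSlice_add, Multiset.count_add, ih, Multiset.count_add]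
    congr 1
    obtain ⟨z, f⟩ := y
    by_cases hf : f = e
    · subst hf
      rw [pairSlice, Multiset.filter_singleton, if_pos rfl, Multiset.map_singleton]
      simp [Multiset.count_singleton]
    · have h1 : ¬ ((f : ℕ) = e) := fun h => hf (PNat.eq h)
      have h2 : ¬ (e = f) := fun h => hf h.symm
      rw [pairSlice, Multiset.filter_singleton, if_neg h1]
      simp [h2]

theorem eq_of_pairSlice_eq {m m' : Multiset (α × ℕ+)}
    (h : ∀ e : ℕ+, pairSlice e m = pairSlice e m') : m = m' := by
  classical
  ext ⟨x, e⟩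
  rw [← count_pairSlice, ← count_pairSlice, h]

/-- The parts `e`, each repeated `d x` times for each pair `(x, e)`. -/
def pairParts (m : Multiset (α × ℕ+)) : Multiset ℕ :=
  m.bind fun y => Multiset.replicate (d y.1) (y.2 : ℕ)

theorem sum_pairParts (m : Multiset (α × ℕ+)) : (pairParts d m).sum = pairWeight d m := by
  simp [pairParts, pairWeight, Multiset.sum_bind, mul_comm]

theorem count_pairParts (m : Multiset (α × ℕ+)) (e : ℕ) :
    (pairParts d m).count e = ((pairSlice e m).map d).sum := by
  induction m using Multiset.induction with
  | empty => simp [pairParts, pairSlice]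
  | cons y m ih =>
    rw [← Multiset.singleton_add, pairSlice_add, Multiset.map_add, Multiset.sum_add, ← ih]
    simp only [pairParts, Multiset.add_bind, Multiset.singleton_bind, Multiset.count_add]
    congr 1
    by_cases h : (y.2 : ℕ) = e <;>
      simp [pairSlice, h, Multiset.filter_singleton, Multiset.count_replicate]

/-- The partition of `n` with parts `pairParts d m`. -/
def pairPartition {n : ℕ} (m : Multiset (α × ℕ+)) (hm : pairWeight d m = n) : n.Partition where
  parts := pairParts d m
  parts_pos := by
    intro i hi
    obtain ⟨y, -, h⟩ := Multiset.mem_bind.1 hi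
    rw [Multiset.eq_of_mem_replicate h]
    exact y.2.pos
  parts_sum := by rw [sum_pairParts, hm]

/-- Glues prescribed slices into one multiset. Positivity is needed because `toPNat'` sends 0 to 1.
-/
theorem pairSlice_sum_map (s : Finset ℕ) (g : ℕ → Multiset α) (hs : ∀ i ∈ s, 0 < i) {e : ℕ} :
    pairSlice e (∑ i ∈ s, (g i).map fun x => (x, i.toPNat')) = if e ∈ s then g e else 0 := by
  classical
  induction s using Finset.induction with
  | empty => simp [pairSlice]
  | insert i s hi ih =>
    rw [Finset.sum_insert hi, pairSlice_add, ih fun i h => hs i (Finset.mem_insert_of_mem h)]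
    have hi0 : ((i.toPNat' : ℕ+) : ℕ) = i := 
      PNat.toPNat'_coe (hs i (Finset.mem_insert_self i s))
    have h1 : pairSlice e ((g i).map fun x => (x, i.toPNat')) = if i = e then g i else 0 := by
      rw [pairSlice, Multiset.filter_map, Multiset.map_map]
      simp only [Function.comp_def, hi0]
      split_ifs with h <;> simp [h]
    rw [h1]
    by_cases h : i = e
    · subst h; simp [hi]
    · have h' : ¬ e = i := fun h' => h h'.symm
      simp [h, h']

variable (hd : ∀ x, 0 < d x)
include hd in
theorem multiset_eq_zero_of_sum_eq_zero {s : Multiset α} (h : (s.map d).sum = 0) : s = 0 := by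
  rw [Multiset.sum_eq_zero_iff] at h
  refine Multiset.eq_zero_of_forall_notMem fun x hx => ?_
  exact (hd x).ne' (h _ (Multiset.mem_map_of_mem d hx))

include hd in
-- Fixing the partition only fixes the total degree of each slice, namely the multiplicity of e; the
-- slices are otherwise independent. A slice at a non-part has total degree 0, so it is empty
-- because all degrees are positive.
theorem bijective_pairSlices (n : ℕ) (p : n.Partition) :
    Function.Bijective fun (m : {m : {m : Multiset (α × ℕ+) // pairWeight d m = n} //
      pairPartition d m.1 m.2 = p}) => fun e : p.parts.toFinset =>
        (⟨pairSlice e m.1.1, by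
          rw [← count_pairParts]; exact congrArg (fun p : n.Partition => p.parts.count e.1) m.2⟩ : {s : Multiset α // (s.map d).sum = p.parts.count ↑e}) := by
  have key : ∀ (m : Multiset (α × ℕ+)) (hm : pairWeight d m = n), pairPartition d m hm = p →
      ∀ e, e ∉ p.parts → pairSlice e m = 0 := by
    rintro m hm rfl e he
    apply multiset_eq_zero_of_sum_eq_zero d hd
    rw [← count_pairParts]
    exact Multiset.count_eq_zero.2 he
  constructor
  · rintro ⟨⟨m, hm⟩, hp⟩ ⟨⟨m', hm'⟩, hp'⟩ h
    simp only [Subtype.mk.injEq]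
    apply eq_of_pairSlice_eq
    intro e
    by_cases he : (e : ℕ) ∈ p.parts
    · have := congrFun h ⟨e, by simpa using he⟩
      simpa using this
    · rw [key m hm hp e he, key m' hm' hp' e he]
  · intro g
    let g' : ℕ → Multiset α := fun i => if h : i ∈ p.parts.toFinset then (g ⟨i, h⟩).1 else 0
    let m : Multiset (α × ℕ+) := ∑ i ∈ p.parts.toFinset, (g' i).map fun x => (x, i.toPNat')
    have hm : ∀ e, pairSlice e m = g' e := by
      intro e
      rw [pairSlice_sum_map _ _ fun i hi => p.parts_pos (by simpa using hi)]
      split_ifs with h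
      · rfl
      · simp only [g', dif_neg h]
    have hp : pairParts d m = p.parts := by
      ext e
      rw [count_pairParts, hm]
      by_cases h : e ∈ p.parts.toFinset
      · simp only [g', h, dif_pos]
        exact (g ⟨e, h⟩).2
      · simp only [g', h, dif_neg, not_false_eq_true]
        simpa [eq_comm] using h
    have hw : pairWeight d m = n := by rw [← sum_pairParts, hp, p.parts_sum]
    refine ⟨⟨⟨m, hw⟩, Nat.Partition.ext hp⟩, ?_⟩
    ext e : 2
    simp only [hm]
    simp [g', e.2, -Multiset.mem_toFinset]

include hd in
theorem card_pairWeight_eq (hfin : ∀ j, Finite {s : Multiset α // (s.map d).sum = j}) (n : ℕ) :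
    Finite {m : Multiset (α × ℕ+) // pairWeight d m = n} ∧
    Nat.card {m : Multiset (α × ℕ+) // pairWeight d m = n} = ∑ p : n.Partition,
      p.parts.toFinsupp.prod fun _ c => Nat.card {s : Multiset α // (s.map d).sum = c} := by
  let e : (p : n.Partition) → _ := fun p => Equiv.ofBijective _ (bijective_pairSlices d hd n p)
  let E := (Equiv.sigmaFiberEquiv fun m : {m : Multiset (α × ℕ+) // pairWeight d m = n} =>
    pairPartition d m.1 m.2).symm.trans (Equiv.sigmaCongrRight e)
  refine ⟨Finite.of_equiv _ E.symm, ?_⟩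
  rw [Nat.card_congr E, Nat.card_sigma]
  refine Finset.sum_congr rfl fun p _ => ?_
  rw [Nat.card_pi, Finsupp.prod, Multiset.toFinsupp_support]
  simp only [Multiset.toFinsupp_apply]
  rw [Finset.prod_coe_sort p.parts.toFinset
    (fun i => Nat.card {s : Multiset α // (s.map d).sum = p.parts.count i})]
end

/-! ### Monic polynomials and the infinite products -/

/-- The closed points of the affine line over `k` outside the zeros of the polynomial `a`. -/
abbrev ClosedPoint {k : Type*} [Field k] (a : Polynomial k) : Type _ :=
  {p : Polynomial k // p.Monic ∧ Irreducible p ∧ IsCoprime p a}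

/-- The degree of a closed point. -/
noncomputable def ClosedPoint.deg {k : Type*} [Field k] {a : Polynomial k} (p : ClosedPoint a) : ℕ :=
  p.1.natDegree

section
variable {k : Type*} [Field k] {a : Polynomial k}

theorem ClosedPoint.deg_pos (p : ClosedPoint a) : 0 < p.deg :=
  p.2.2.1.natDegree_pos

open UniqueFactorizationMonoid in
-- Unique factorization in k[X]: the inverse is `normalizedFactors`, whose members are monic and, as
-- divisors of f, still coprime to a.
theorem bijective_multiset_prod (j : ℕ) :
    Function.Bijective fun s : {s : Multiset (ClosedPoint a) // (s.map ClosedPoint.deg).sum = j} =>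
      (⟨(s.1.map Subtype.val).prod,
        Polynomial.monic_multiset_prod_of_monic _ _ fun p _ => p.2.1, by
          rw [Polynomial.natDegree_multiset_prod_of_monic, Multiset.map_map]
          · exact s.2
          · intro f hf
            obtain ⟨p, -, rfl⟩ := Multiset.mem_map.1 hf
            exact p.2.1, by
          refine Multiset.prod_induction (fun f => IsCoprime f a) _
            (fun _ _ => IsCoprime.mul_left) isCoprime_one_left ?_
          intro f hf
          obtain ⟨p, -, rfl⟩ := Multiset.mem_map.1 hf
          exact p.2.2.2⟩ :
        {f : Polynomial k // f.Monic ∧ f.natDegree = j ∧ IsCoprime f a}) := by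
  classical
  constructor
  · rintro ⟨s, hs⟩ ⟨t, ht⟩ h
    simp only [Subtype.mk.injEq] at h ⊢
    have key : ∀ s : Multiset (ClosedPoint a),
        normalizedFactors (s.map Subtype.val).prod = s.map Subtype.val := by
      intro s
      rw [normalizedFactors_prod_eq, Multiset.map_map]
      · exact Multiset.map_congr rfl fun p _ => p.2.1.normalize_eq_self
      · intro f hf
        obtain ⟨p, -, rfl⟩ := Multiset.mem_map.1 hf
        exact p.2.2.1
    apply Multiset.map_injective Subtype.val_injective
    rw [← key s, ← key t, h]
  · rintro ⟨f, hf, hj, hc⟩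
    obtain ⟨s, hs⟩ : ∃ s : Multiset (ClosedPoint a), s.map Subtype.val = normalizedFactors f := by
      have : ∀ p ∈ normalizedFactors f, p.Monic ∧ Irreducible p ∧ IsCoprime p a := by
        intro p hp
        refine ⟨?_, irreducible_of_normalized_factor p hp,
          hc.of_isCoprime_of_dvd_left (dvd_of_mem_normalizedFactors hp)⟩
        rw [← normalize_normalized_factor p hp]
        exact Polynomial.monic_normalize (ne_zero_of_mem_normalizedFactors hp)
      exact ⟨(normalizedFactors f).pmap Subtype.mk this, by
        simp [Multiset.map_pmap, Multiset.pmap_eq_map]⟩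
    have hp : (s.map Subtype.val).prod = f := by
      rw [hs]
      have h := prod_normalizedFactors hf.ne_zero
      refine Polynomial.eq_of_monic_of_associated ?_ hf h
      rw [← hs]
      exact Polynomial.monic_multiset_prod_of_monic _ _ fun p _ => p.2.1
    refine ⟨⟨s, ?_⟩, Subtype.ext hp⟩
    rw [← hj, ← hp, Polynomial.natDegree_multiset_prod_of_monic, Multiset.map_map]
    · rfl
    · intro f hf
      obtain ⟨p, -, rfl⟩ := Multiset.mem_map.1 hf
      exact p.2.1

theorem card_monic_natDegree_eq [Finite k] (j : ℕ) :
    Finite {f : Polynomial k // f.Monic ∧ f.natDegree = j} ∧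
    Nat.card {f : Polynomial k // f.Monic ∧ f.natDegree = j} = Nat.card k ^ j := by
  let e := (Polynomial.monicEquivDegreeLT (R := k) j).trans (Polynomial.degreeLTEquiv k j).toEquiv
  refine ⟨Finite.of_equiv _ e.symm, ?_⟩
  rw [Nat.card_congr e, Nat.card_fun, Nat.card_fin]

theorem card_multiset_closedPoint [Finite k] (a : Polynomial k) (j : ℕ) :
    Finite {s : Multiset (ClosedPoint a) // (s.map ClosedPoint.deg).sum = j} ∧
    Nat.card {s : Multiset (ClosedPoint a) // (s.map ClosedPoint.deg).sum = j} =
      Nat.card {f : Polynomial k // f.Monic ∧ f.natDegree = j ∧ IsCoprime f a} := by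
  let e := Equiv.ofBijective _ (bijective_multiset_prod (a := a) j)
  have := (card_monic_natDegree_eq (k := k) j).1
  have : Finite {f : Polynomial k // f.Monic ∧ f.natDegree = j ∧ IsCoprime f a} :=
    Finite.of_injective (fun f => (⟨f.1, f.2.1, f.2.2.1⟩ :
      {f : Polynomial k // f.Monic ∧ f.natDegree = j})) fun f g h => by
        simpa [Subtype.ext_iff] using h
  exact ⟨Finite.of_equiv _ e.symm, Nat.card_congr e⟩

theorem card_monic_coprime_one [Finite k] (j : ℕ) :
    Nat.card {f : Polynomial k // f.Monic ∧ f.natDegree = j ∧ IsCoprime f 1} = Nat.card k ^ j := by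
  rw [← (card_monic_natDegree_eq (k := k) j).2]
  simp [isCoprime_one_right]

theorem isCoprime_X_iff (f : Polynomial k) : IsCoprime f Polynomial.X ↔ ¬ Polynomial.X ∣ f := by
  rw [isCoprime_comm, Polynomial.irreducible_X.coprime_iff_not_dvd]

theorem card_monic_coprime_X_zero [Finite k] :
    Nat.card {f : Polynomial k // f.Monic ∧ f.natDegree = 0 ∧ IsCoprime f Polynomial.X} = 1 := by
  rw [Nat.card_eq_one_iff_exists]
  refine ⟨⟨1, Polynomial.monic_one, Polynomial.natDegree_one, isCoprime_one_left⟩, ?_⟩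
  rintro ⟨f, hf, h, -⟩
  exact Subtype.ext (hf.natDegree_eq_zero.1 h)

/-- The monic polynomials of degree j + 1 not coprime to X are the products X · f with f monic of
degree j. -/
theorem card_monic_coprime_X_succ [Finite k] (j : ℕ) :
    Nat.card {f : Polynomial k // f.Monic ∧ f.natDegree = j + 1 ∧ IsCoprime f Polynomial.X} +
      Nat.card k ^ j = Nat.card k ^ (j + 1) := by
  classical
  have hfin := (card_monic_natDegree_eq (k := k) (j + 1)).1
  have hfin' := (card_monic_natDegree_eq (k := k) j).1
  rw [← (card_monic_natDegree_eq (k := k) (j + 1)).2, ← (card_monic_natDegree_eq (k := k) j).2,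
    Nat.card_congr (Equiv.sumCompl
      fun f : {f : Polynomial k // f.Monic ∧ f.natDegree = j + 1} => Polynomial.X ∣ f.1).symm,
    Nat.card_sum, add_comm]
  congr 1
  · refine Nat.card_eq_of_bijective (fun f => ⟨⟨Polynomial.X * f.1, Polynomial.monic_X.mul f.2.1, ?_⟩,
      dvd_mul_right _ _⟩) ⟨?_, ?_⟩
    · rw [Polynomial.natDegree_X_mul f.2.1.ne_zero, f.2.2]
    · rintro ⟨f, hf⟩ ⟨g, hg⟩ h
      simpa using h
    · rintro ⟨⟨f', hm, hd⟩, h⟩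
      obtain ⟨f, h⟩ := h
      obtain rfl : f' = Polynomial.X * f := h
      have hf : f.Monic := Polynomial.monic_X.of_mul_monic_left hm
      refine ⟨⟨f, hf, ?_⟩, rfl⟩
      rw [Polynomial.natDegree_X_mul hf.ne_zero] at hd
      omega
  · refine Nat.card_eq_of_bijective (fun f => ⟨⟨f.1, f.2.1, f.2.2.1⟩,
      (isCoprime_X_iff _).1 f.2.2.2⟩) ⟨?_, ?_⟩
    · rintro ⟨f, hf⟩ ⟨g, hg⟩ h
      simpa using h
    · rintro ⟨⟨f, hm, hd⟩, h⟩
      exact ⟨⟨f, hm, hd, (isCoprime_X_iff _).2 h⟩, rfl⟩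

/-- The number of multisets of pairs `(p, e)` of weight `n`, with `p` a closed point outside the
zeros of `a`. -/
noncomputable def pairCount (a : Polynomial k) (n : ℕ) : ℕ :=
  Nat.card {m : Multiset (ClosedPoint a × ℕ+) // pairWeight ClosedPoint.deg m = n}

/-- Common source of both products: g i is the numerator of the i-th factor, to be taken as 1 for a
= 1 and 1 - T^i for a = X. -/
theorem hasProd_pairCount [Finite k] (a : Polynomial k) (N : ℕ → ℤ)
    (hN : ∀ j, (Nat.card {f : Polynomial k // f.Monic ∧ f.natDegree = j ∧ IsCoprime f a} : ℤ) = N j)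
    (hN0 : N 0 = 1) (g : ℕ → ℤ⟦X⟧) (hg : ∀ i ≠ 0, ∀ n, coeff n (g i) = if i ∣ n then
      (if n = 0 then 1 else N (n / i) - Nat.card k * N (n / i - 1)) else 0) :
    HasProd (fun i : ℕ+ => g i * seriesInv (1 - PowerSeries.C (Nat.card k : ℤ) * X ^ (i : ℕ)))
      (PowerSeries.mk fun n => (pairCount a n : ℤ)) := by
  have h := hasProd_pnat_of_nat (f := fun i => g i *
    seriesInv (1 - PowerSeries.C (Nat.card k : ℤ) * X ^ i))
    (g := (Nat.Partition.genFun fun _ j => N j)) ?_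
  · convert h using 1
    ext n
    rw [coeff_mk, Nat.Partition.coeff_genFun, pairCount,
      (card_pairWeight_eq _ ClosedPoint.deg_pos (fun j => (card_multiset_closedPoint a j).1) n).2]
    push_cast
    refine Finset.sum_congr rfl fun p _ => ?_
    rw [Finsupp.prod, Finsupp.prod]
    refine Finset.prod_congr rfl fun i _ => ?_
    rw [(card_multiset_closedPoint a _).2, hN]
  · have h := Nat.Partition.hasProd_genFun fun (_ : ℕ) j => N j
    refine (congrArg (fun F : ℕ → ℤ⟦X⟧ => HasProd F _) (funext fun i => ?_)).mpr h
    refine (one_add_tsum_eq_mul N hN0 _ (i + 1) i.succ_ne_zero _ _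
      (mul_seriesInv _ ?_) (hg (i + 1) i.succ_ne_zero)).symm
    simp

theorem hasProd_pairCount_one [Finite k] :
    HasProd (fun i : ℕ+ => seriesInv (1 - PowerSeries.C (Nat.card k : ℤ) * X ^ (i : ℕ)))
      (PowerSeries.mk fun n => (pairCount (1 : Polynomial k) n : ℤ)) := by
  have h := hasProd_pairCount (1 : Polynomial k) (fun j => (Nat.card k : ℤ) ^ j)
    (fun j => by rw [card_monic_coprime_one]; push_cast; rfl) (pow_zero _) (fun _ => 1) ?_
  · simpa using h
  · intro i hi n
    rcases Nat.eq_zero_or_pos n with rfl | hn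
    · simp
    · rw [coeff_one, if_neg hn.ne', if_neg hn.ne']
      split_ifs with h
      · obtain ⟨j, rfl⟩ := h
        have hj : j ≠ 0 := by rintro rfl; simp at hn
        obtain ⟨j, rfl⟩ := Nat.exists_eq_succ_of_ne_zero hj
        rw [Nat.mul_div_cancel_left _ (Nat.pos_of_ne_zero hi)]
        simp [pow_succ, mul_comm]
      · rfl

theorem hasProd_pairCount_X [Finite k] :
    HasProd (fun i : ℕ+ => (1 - (X : ℤ⟦X⟧) ^ (i : ℕ)) *
        seriesInv (1 - PowerSeries.C (Nat.card k : ℤ) * X ^ (i : ℕ)))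
      (PowerSeries.mk fun n => (pairCount (Polynomial.X : Polynomial k) n : ℤ)) := by
  have hz : ((Nat.card {f : Polynomial k // f.Monic ∧ f.natDegree = 0 ∧
      IsCoprime f Polynomial.X} : ℕ) : ℤ) = 1 := by exact_mod_cast card_monic_coprime_X_zero
  have hs : ∀ j, ((Nat.card {f : Polynomial k // f.Monic ∧ f.natDegree = j + 1 ∧
      IsCoprime f Polynomial.X} : ℕ) : ℤ) = (Nat.card k : ℤ) ^ (j + 1) - (Nat.card k : ℤ) ^ j := by
    intro j
    rw [eq_sub_iff_add_eq]
    exact_mod_cast card_monic_coprime_X_succ (k := k) j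
  refine hasProd_pairCount (Polynomial.X : Polynomial k) _ (fun j => rfl) hz
    (fun i => 1 - X ^ i) ?_
  intro i hi n
  have hi' := Nat.pos_of_ne_zero hi
  rw [map_sub, coeff_one, coeff_X_pow]
  rcases Nat.eq_zero_or_pos n with rfl | hn
  · simp [hi.symm]
  · rw [if_neg hn.ne', if_neg hn.ne']
    by_cases h : i ∣ n
    · obtain ⟨j, rfl⟩ := h
      have hj : j ≠ 0 := by rintro rfl; simp at hn
      obtain ⟨j, rfl⟩ := Nat.exists_eq_succ_of_ne_zero hj
      rw [if_pos (dvd_mul_right _ _), Nat.mul_div_cancel_left _ hi', Nat.succ_sub_one,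
        Nat.succ_eq_add_one, hs]
      -- Quotient 1 gives (q - 1) - q = -1, the coefficient of -T^i; for larger quotients the two
      -- differences cancel.
      rcases j with _ | j
      · rw [hz]; simp
      · rw [hs, if_neg]
        · ring
        · intro h
          have := Nat.eq_of_mul_eq_mul_left hi' (h.trans (mul_one i).symm)
          omega
    · rw [if_neg h, if_neg]
      · simp
      · rintro rfl; exact h dvd_rfl
end

/-! ### Colorings as multisets of pairs -/

theorem sigma_partition_ext {c c' : Σ n : ℕ, n.Partition} (h : c.2.parts = c'.2.parts) :
    c = c' := by
  obtain ⟨n, p⟩ := c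
  obtain ⟨n', p'⟩ := c'
  obtain rfl : n = n' := by
    rw [← p.parts_sum, ← p'.parts_sum]
    exact congrArg _ h
  congr
  exact Nat.Partition.ext h

section
variable {α P : Type*}

open Classical in
/-- The second components of the pairs in a multiset that have first component `x`. -/
noncomputable def pairFiber (x : α) (m : Multiset (α × ℕ+)) : Multiset ℕ :=
  (m.filter fun y => y.1 = x).map fun y => (y.2 : ℕ)

theorem pairFiber_add (x : α) (m m' : Multiset (α × ℕ+)) :
    pairFiber x (m + m') = pairFiber x m + pairFiber x m' := by
  simp [pairFiber]

theorem count_pairFiber [DecidableEq α] (x : α) (m : Multiset (α × ℕ+)) (e : ℕ+) :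
    (pairFiber x m).count (e : ℕ) = m.count (x, e) := by
  induction m using Multiset.induction with
  | empty => simp [pairFiber]
  | cons y m ih =>
    rw [← Multiset.singleton_add, pairFiber_add, Multiset.count_add, ih, Multiset.count_add]
    congr 1
    obtain ⟨z, f⟩ := y
    rw [pairFiber, Multiset.filter_singleton]
    by_cases h : z = x
    · subst h
      simp [Multiset.count_singleton]
    · have h' : ¬ x = z := fun h' => h h'.symm
      simp [h, h']

theorem pairFiber_sum_map (s : Finset α) (g : α → Multiset ℕ) (hg : ∀ x, ∀ i ∈ g x, 0 < i)
    [DecidableEq α] (x : α) :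
    pairFiber x (∑ z ∈ s, (g z).map fun i => (z, i.toPNat')) = if x ∈ s then g x else 0 := by
  induction s using Finset.induction with
  | empty => simp [pairFiber]
  | insert z s hz ih =>
    rw [Finset.sum_insert hz, pairFiber_add, ih]
    have h1 : pairFiber x ((g z).map fun i => (z, i.toPNat')) = if z = x then g z else 0 := by
      rw [pairFiber, Multiset.filter_map, Multiset.map_map]
      split_ifs with h
      · subst h
        simp only [Function.comp_def, Multiset.filter_true]
        exact (Multiset.map_congr rfl fun i hi => PNat.toPNat'_coe (hg z i hi)).trans
          (Multiset.map_id' _)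
      · simp [h]
    rw [h1]
    by_cases h : z = x
    · subst h; simp [hz]
    · have h' : ¬ x = z := fun h' => h h'.symm
      simp [h, h']

/-- The partition with parts the second components of the pairs with first component `x`. -/
noncomputable def pairFiberColor (m : Multiset (α × ℕ+)) (x : α) : partitionColors.Color :=
  ⟨(pairFiber x m).sum, pairFiber x m, by
    intro i hi
    obtain ⟨y, -, rfl⟩ := Multiset.mem_map.1 hi
    exact y.2.pos, rfl⟩

variable {F : P → P} (π : P → α) (d : α → ℕ)

theorem finite_support_pairFiber (hfib : ∀ x, {y | π y = x}.Finite) (m : Multiset (α × ℕ+)) :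
    {y | (pairFiber (π y) m).sum ≠ 0}.Finite := by
  classical
  refine ((m.map Prod.fst).toFinset.finite_toSet.biUnion fun x _ => hfib x).subset ?_
  intro y hy
  simp only [Set.mem_iUnion, Set.mem_ofPred_eq, exists_prop, exists_eq_right', Finset.mem_coe]
  by_contra h
  apply hy
  rw [pairFiber, Multiset.filter_eq_nil.2, Multiset.map_zero, Multiset.sum_zero]
  rintro z hz hzy
  exact h (Multiset.mem_toFinset.2 (hzy ▸ Multiset.mem_map_of_mem Prod.fst hz))

/-- The coloring in which the color at `y` has parts the second components of the pairs with
first component `π y`. -/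
noncomputable def coloringOfPairs (hF : ∀ y, π (F y) = π y) (hfib : ∀ x, {y | π y = x}.Finite)
    (m : Multiset (α × ℕ+)) : Coloring partitionColors F where
  color y := pairFiberColor m (π y)
  finite_support := by
    refine (finite_support_pairFiber π hfib m).subset fun y hy h => hy ?_
    exact (partitionColors.deg_eq_zero_iff _).1 h
  frob_fixed y := by rw [hF]

/-- Both sides are additive in m, and a single pair (x, e) contributes e at each of the `d x` points
above x. -/
theorem degree_coloringOfPairs (hF : ∀ y, π (F y) = π y) (hfib : ∀ x, {y | π y = x}.Finite)
    (hcard : ∀ x, {y | π y = x}.ncard = d x) (m : Multiset (α × ℕ+)) :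
    (coloringOfPairs π hF hfib m).degree = pairWeight d m := by
  classical
  change ∑ᶠ y, (pairFiber (π y) m).sum = _
  induction m using Multiset.induction with
  | empty => simp [pairFiber, pairWeight]
  | cons z m ih =>
    rw [← Multiset.singleton_add, pairWeight_add, ← ih]
    simp only [pairFiber_add, Multiset.sum_add]
    rw [finsum_add_distrib (finite_support_pairFiber π hfib _) (finite_support_pairFiber π hfib _)]
    congr 1
    have h1 : ∀ y, (pairFiber (π y) {z}).sum = ∑ᶠ (_ : y ∈ {y | π y = z.1}), (z.2 : ℕ) := by
      intro y
      rw [finsum_eq_if, pairFiber, Multiset.filter_singleton]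
      by_cases h : z.1 = π y
      · simp [h]
      · have h' : ¬ π y = z.1 := fun h' => h h'.symm
        simp [h, h']
    rw [finsum_congr h1, finsum_mem_eq_finite_toFinset_sum _ (hfib z.1), Finset.sum_const,
      ← Set.ncard_eq_toFinset_card _ (hfib z.1), hcard]
    simp [pairWeight, mul_comm]

theorem Coloring.color_injective {C : ColorSet} : Function.Injective (Coloring.color (C := C) (F := F)) := by
  rintro ⟨c, _, _⟩ ⟨c', _, _⟩ h
  cases h
  rfl

theorem Coloring.color_iterate {C : ColorSet} (L : Coloring C F) (n : ℕ) (y : P) :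
    L.color (F^[n] y) = L.color y := by
  induction n with
  | zero => rfl
  | succ n ih => rw [Function.iterate_succ_apply', L.frob_fixed, ih]

/-- By `horb` the fibres of π are single Frobenius orbits, so a coloring is constant on them and
descends along π; the parts of its colors at chosen representatives are then glued into a multiset.
-/
theorem bijective_coloringOfPairs (hF : ∀ y, π (F y) = π y) (hfib : ∀ x, {y | π y = x}.Finite)
    (hsurj : Function.Surjective π) (horb : ∀ y y', π y = π y' → ∃ n, F^[n] y = y') :
    Function.Bijective (coloringOfPairs π hF hfib) := by
  classical
  constructor
  · intro m m' h
    ext ⟨x, e⟩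
    obtain ⟨y, rfl⟩ := hsurj x
    have h1 := congrFun (congrArg Coloring.color h) y
    have h2 : pairFiber (π y) m = pairFiber (π y) m' :=
      congrArg (fun c : Σ n : ℕ, n.Partition => c.2.parts) h1
    rw [← count_pairFiber, ← count_pairFiber, h2]
  · intro L
    choose s hs using hsurj
    have hcol : ∀ y, L.color y = L.color (s (π y)) := by
      intro y
      obtain ⟨n, hn⟩ := horb y (s (π y)) (hs _).symm
      rw [← hn, L.color_iterate]
    let g : α → Multiset ℕ := fun x => Nat.Partition.parts (Sigma.snd (L.color (s x)))
    let S : Finset α := L.finite_support.toFinset.image π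
    refine ⟨∑ z ∈ S, (g z).map fun i => (z, i.toPNat'), Coloring.color_injective ?_⟩
    funext y
    apply sigma_partition_ext
    change pairFiber (π y) _ = _
    rw [pairFiber_sum_map S g (fun x i hi => Nat.Partition.parts_pos _ hi)]
    split_ifs with h
    · simp only [g]
      rw [← hcol]
    · by_cases h0 : L.color y = partitionColors.zero
      · rw [h0]
        rfl
      · exact absurd (Finset.mem_image_of_mem π (L.finite_support.mem_toFinset.2 h0)) h

theorem isColoringZeta_pairWeight (hF : ∀ y, π (F y) = π y) (hpos : ∀ x, 0 < d x)
    (hcard : ∀ x, {y | π y = x}.ncard = d x) (horb : ∀ y y', π y = π y' → ∃ n, F^[n] y = y')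
    (hfin : ∀ n, Finite {m : Multiset (α × ℕ+) // pairWeight d m = n}) :
    IsColoringZeta partitionColors F (PowerSeries.mk fun n =>
      (Nat.card {m : Multiset (α × ℕ+) // pairWeight d m = n} : ℤ)) := by
  -- `ncard` is 0 on infinite sets as well as on the empty set, so this yields finiteness of the
  -- fibres and surjectivity of π at once.
  have hne : ∀ x, {y | π y = x}.ncard ≠ 0 := fun x => by rw [hcard]; exact (hpos x).ne'
  have hfib : ∀ x, {y | π y = x}.Finite := fun x => Set.finite_of_ncard_ne_zero (hne x)
  have hsurj : Function.Surjective π := fun x => Set.nonempty_of_ncard_ne_zero (hne x)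
  let E := Equiv.ofBijective _ (bijective_coloringOfPairs π hF hfib hsurj horb)
  have e : ∀ n, {m : Multiset (α × ℕ+) // pairWeight d m = n} ≃
      {L : Coloring partitionColors F // L.degree = n} := fun n =>
    E.subtypeEquiv fun m => by
      rw [← degree_coloringOfPairs π d hF hfib hcard]; rfl
  exact hasSum_X_pow_of_card _ _ (fun n => Finite.of_equiv _ (e n))
    fun n => (Nat.card_congr (e n)).symm
end

/-! ### Frobenius orbits and minimal polynomials -/

section
variable {k K : Type*} [Field k] [Finite k] [Field K] [Algebra k K] [IsAlgClosure k K]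

/-- Some automorphism σ of K over k sends x to y. It need not be a power of Frobenius, but its
restriction to the finite extension k(x) is. -/
theorem exists_pow_card_pow_eq_of_minpoly_eq {x y : K} (h : minpoly k x = minpoly k y) :
    ∃ n : ℕ, x ^ Nat.card k ^ n = y := by
  have := Fintype.ofFinite k
  have : Normal k K := IsAlgClosure.normal k K
  obtain ⟨σ, hσ⟩ := isConjRoot_iff_exists_algEquiv.1 (h.symm : IsConjRoot k y x)
  have hx : IsIntegral k x := Algebra.IsIntegral.isIntegral x
  let E := IntermediateField.adjoin k {x}
  have : FiniteDimensional k E := IntermediateField.adjoin.finiteDimensional hx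
  have : Finite E := Module.finite_of_finite k
  have hE : IsGalois k E := inferInstance
  let τ := σ.restrictNormal E
  obtain ⟨n, hn⟩ := (FiniteField.bijective_frobeniusAlgEquivOfAlgebraic_pow k E).2 τ
  refine ⟨n, ?_⟩
  let x' : E := ⟨x, IntermediateField.mem_adjoin_simple_self k x⟩
  have h1 : algebraMap E K (τ x') = y := by
    rw [AlgEquiv.restrictNormal_commutes]; exact hσ
  rw [← h1, ← hn]
  simp only [AlgEquiv.coe_pow]
  rw [FiniteField.coe_frobeniusAlgEquivOfAlgebraic_iterate, map_pow, Nat.card_eq_fintype_card]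
  rfl

theorem minpoly_pow_card (x : K) : minpoly k (x ^ Nat.card k) = minpoly k x := by
  have := Fintype.ofFinite k
  have : Algebra.IsAlgebraic k K := IsAlgClosure.isAlgebraic
  rw [← minpoly.algEquiv_eq (FiniteField.frobeniusAlgEquivOfAlgebraic k K) x,
    FiniteField.coe_frobeniusAlgEquivOfAlgebraic, Nat.card_eq_fintype_card]

/-- Finite fields are perfect, so p is separable and has deg p distinct roots in K. -/
theorem ncard_minpoly_eq {p : Polynomial k} (hm : p.Monic) (hp : Irreducible p) :
    {x : K | minpoly k x = p}.ncard = p.natDegree := by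
  have : IsAlgClosed K := IsAlgClosure.isAlgClosed k
  have h : {x : K | minpoly k x = p} = p.rootSet K := by
    ext x
    rw [Polynomial.mem_rootSet_of_ne hp.ne_zero]
    constructor
    · rintro rfl
      exact minpoly.aeval k x
    · intro h
      exact (minpoly.eq_of_irreducible_of_monic hp h hm).symm
  rw [h, ← Nat.card_coe_set_eq, Nat.card_eq_fintype_card,
    Polynomial.card_rootSet_eq_natDegree (PerfectField.separable_of_irreducible hp)
      (IsAlgClosed.splits _)]

theorem isColoringZeta_frobGa :
    IsColoringZeta partitionColors (frobGa k K)
      (PowerSeries.mk fun n => (pairCount (1 : Polynomial k) n : ℤ)) := by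
  have : Algebra.IsAlgebraic k K := IsAlgClosure.isAlgebraic
  have hx : ∀ x : K, IsIntegral k x := Algebra.IsIntegral.isIntegral
  refine isColoringZeta_pairWeight (fun x => ⟨minpoly k x, minpoly.monic (hx x),
    minpoly.irreducible (hx x), isCoprime_one_right⟩) ClosedPoint.deg ?_ ClosedPoint.deg_pos ?_ ?_ ?_
  · intro x
    exact Subtype.ext (minpoly_pow_card x)
  · intro p
    rw [ClosedPoint.deg, ← ncard_minpoly_eq (K := K) p.2.1 p.2.2.1]
    congr 1
    ext x
    simp [Subtype.ext_iff]
  · intro x y h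
    obtain ⟨n, hn⟩ := exists_pow_card_pow_eq_of_minpoly_eq (congrArg Subtype.val h)
    refine ⟨n, ?_⟩
    rw [← hn]
    exact congrFun (pow_iterate (Nat.card k) n) x
  · exact fun n => (card_pairWeight_eq _ ClosedPoint.deg_pos
      (fun j => (card_multiset_closedPoint _ j).1) n).1

theorem isColoringZeta_frobGm :
    IsColoringZeta partitionColors (frobGm k K)
      (PowerSeries.mk fun n => (pairCount (Polynomial.X : Polynomial k) n : ℤ)) := by
  have : Algebra.IsAlgebraic k K := IsAlgClosure.isAlgebraic
  have hx : ∀ x : K, IsIntegral k x := Algebra.IsIntegral.isIntegral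
  have h0 : ∀ x : Kˣ, IsCoprime (minpoly k (x : K)) Polynomial.X := fun x => by
    rw [isCoprime_X_iff, Polynomial.X_dvd_iff]
    exact minpoly.coeff_zero_ne_zero (hx x) x.ne_zero
  refine isColoringZeta_pairWeight (fun x => ⟨minpoly k (x : K), minpoly.monic (hx x),
    minpoly.irreducible (hx x), h0 x⟩) ClosedPoint.deg ?_ ClosedPoint.deg_pos ?_ ?_ ?_
  · intro x
    apply Subtype.ext
    simp only [frobGm, Units.val_pow_eq_pow_val]
    exact minpoly_pow_card _
  · intro p
    rw [ClosedPoint.deg, ← ncard_minpoly_eq (K := K) p.2.1 p.2.2.1,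
      ← Set.ncard_image_of_injective _ (Units.val_injective (α := K))]
    congr 1
    ext x
    simp only [Set.mem_image, Set.mem_ofPred_eq, Subtype.ext_iff]
    constructor
    · rintro ⟨u, hu, rfl⟩
      exact hu
    · intro h
      -- Since p is coprime to X, 0 is not among its roots: restricting to units loses no point of
      -- the fibre.
      have hx0 : x ≠ 0 := by
        rintro rfl
        have := (isCoprime_X_iff _).1 p.2.2.2
        rw [Polynomial.X_dvd_iff, ← h] at this
        simp at this
      exact ⟨Units.mk0 x hx0, h, rfl⟩
  · intro x y h
    obtain ⟨n, hn⟩ := exists_pow_card_pow_eq_of_minpoly_eq (congrArg Subtype.val h)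
    refine ⟨n, Units.ext ?_⟩
    rw [← hn, ← Units.val_pow_eq_pow_val]
    exact congrArg Units.val (congrFun (pow_iterate (Nat.card k) n) x)
  · exact fun n => (card_pairWeight_eq _ ClosedPoint.deg_pos
      (fun j => (card_multiset_closedPoint _ j).1) n).1
end

/-! ### Primary types of finite k[X]-modules -/

theorem exists_equiv_comp_eq_of_map_univ_eq {ι ι' β : Type*} [Fintype ι] [Fintype ι']
    (c : ι → β) (c' : ι' → β)
    (h : Finset.univ.val.map c = Finset.univ.val.map c') : ∃ σ : ι ≃ ι', ∀ i, c' (σ i) = c i := by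
  classical
  have key : ∀ b, Nonempty ({i // c i = b} ≃ {i // c' i = b}) := by
    intro b
    rw [← Fintype.card_eq, Fintype.card_subtype, Fintype.card_subtype]
    have := congrArg (Multiset.count b) h
    rw [Multiset.count_map, Multiset.count_map] at this
    simpa [Finset.card, eq_comm] using this
  exact ⟨Equiv.ofFiberEquiv fun b => (key b).some, fun i => Equiv.ofFiberEquiv_map _ i⟩

/-- The number of elements of a module that are annihilated by a scalar. -/
noncomputable def kerCard {R : Type*} (V : Type*) [Semiring R] [AddCommMonoid V] [Module R V] (g : R) : ℕ :=
  Nat.card {v : V // g • v = 0}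

theorem LinearEquiv.kerCard_eq {R V W : Type*} [Semiring R] [AddCommMonoid V] [Module R V]
    [AddCommMonoid W] [Module R W] (e : V ≃ₗ[R] W) (g : R) : kerCard V g = kerCard W g :=
  Nat.card_congr (e.toEquiv.subtypeEquiv fun v => by
    change g • v = 0 ↔ g • e v = 0
    rw [← map_smul, e.map_eq_zero_iff])

theorem kerCard_pi {R ι : Type*} {V : ι → Type*} [Semiring R] [Fintype ι]
    [∀ i, AddCommMonoid (V i)] [∀ i, Module R (V i)] (g : R) :
    kerCard (∀ i, V i) g = ∏ i, kerCard (V i) g := by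
  simp only [kerCard]
  rw [← Nat.card_pi]
  refine Nat.card_congr (Equiv.trans ?_ (Equiv.subtypePiEquivPi (p := fun i (v : V i) => g • v = 0)))
  exact Equiv.subtypeEquivRight fun v => by simp [funext_iff]

section
variable {k : Type*} [Field k]

theorem natCard_quotient_span [Finite k] {f : Polynomial k} (hf : f ≠ 0) :
    Nat.card (Polynomial k ⧸ Ideal.span {f}) = Nat.card k ^ f.natDegree := by
  have : Module.Finite k (Polynomial k ⧸ Ideal.span {f}) :=
    (AdjoinRoot.powerBasis hf).finite
  rw [Module.natCard_eq_pow_finrank (K := k), finrank_quotient_span_eq_natDegree]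

theorem kerCard_of_isCoprime {f g : Polynomial k} (h : IsCoprime f g) :
    kerCard (Polynomial k ⧸ Ideal.span {f}) g = 1 := by
  rw [kerCard, Nat.card_eq_one_iff_exists]
  refine ⟨⟨0, smul_zero _⟩, ?_⟩
  rintro ⟨v, hv⟩
  obtain ⟨v, rfl⟩ := Ideal.Quotient.mk_surjective v
  rw [Subtype.mk.injEq, Ideal.Quotient.eq_zero_iff_mem, Ideal.mem_span_singleton]
  change Ideal.Quotient.mk (Ideal.span {f}) (g * v) = 0 at hv
  rw [Ideal.Quotient.eq_zero_iff_mem, Ideal.mem_span_singleton] at hv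
  exact h.dvd_of_dvd_mul_left hv

theorem kerCard_of_dvd {f g : Polynomial k} (h : f ∣ g) :
    kerCard (Polynomial k ⧸ Ideal.span {f}) g = Nat.card (Polynomial k ⧸ Ideal.span {f}) := by
  refine Nat.card_congr (Equiv.subtypeUnivEquiv fun v => ?_)
  obtain ⟨v, rfl⟩ := Ideal.Quotient.mk_surjective v
  change Ideal.Quotient.mk (Ideal.span {f}) (g * v) = 0
  rw [Ideal.Quotient.eq_zero_iff_mem, Ideal.mem_span_singleton]
  exact h.mul_right v

/-- Multiplication by f embeds k[X]/(g) into k[X]/(fg), with image the kernel of g. -/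
theorem kerCard_mul {f g : Polynomial k} (hf : f ≠ 0) (hg : g ≠ 0) :
    kerCard (Polynomial k ⧸ Ideal.span {f * g}) g = Nat.card (Polynomial k ⧸ Ideal.span {g}) := by
  symm
  let φ : (Polynomial k ⧸ Ideal.span {g}) →ₗ[Polynomial k] (Polynomial k ⧸ Ideal.span {f * g}) :=
    Submodule.mapQ _ _ (LinearMap.mulLeft (Polynomial k) f) fun x hx => by
      rw [Submodule.mem_comap, LinearMap.mulLeft_apply]
      obtain ⟨y, rfl⟩ := Ideal.mem_span_singleton.1 hx
      exact Ideal.mem_span_singleton.2 ⟨y, by ring⟩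
  have hφ : ∀ x, φ (Ideal.Quotient.mk _ x) = Ideal.Quotient.mk _ (f * x) := fun x => rfl
  have hs : ∀ x, g • φ x = 0 := by
    intro x
    obtain ⟨x, rfl⟩ := Ideal.Quotient.mk_surjective x
    rw [hφ]
    change Ideal.Quotient.mk _ (g * (f * x)) = 0
    rw [Ideal.Quotient.eq_zero_iff_mem, Ideal.mem_span_singleton]
    exact ⟨x, by ring⟩
  refine Nat.card_eq_of_bijective (fun x => (⟨φ x, hs x⟩ :
    {v : Polynomial k ⧸ Ideal.span {f * g} // g • v = 0})) ⟨?_, ?_⟩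
  · intro x y h
    have h' : φ x = φ y := congrArg Subtype.val h
    rw [← sub_eq_zero, ← map_sub] at h'
    rw [← sub_eq_zero]
    obtain ⟨z, hz⟩ := Ideal.Quotient.mk_surjective (x - y)
    rw [← hz, hφ, Ideal.Quotient.eq_zero_iff_mem, Ideal.mem_span_singleton] at h'
    rw [← hz, Ideal.Quotient.eq_zero_iff_mem, Ideal.mem_span_singleton]
    exact (mul_dvd_mul_iff_left hf).1 h'
  · rintro ⟨v, hv⟩
    obtain ⟨v, rfl⟩ := Ideal.Quotient.mk_surjective v
    have hv' : Ideal.Quotient.mk (Ideal.span {f * g}) (g * v) = 0 := hv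
    rw [Ideal.Quotient.eq_zero_iff_mem, Ideal.mem_span_singleton, mul_comm f,
      mul_dvd_mul_iff_left hg] at hv'
    obtain ⟨y, rfl⟩ := hv'
    exact ⟨Ideal.Quotient.mk _ y, rfl⟩

variable {a : Polynomial k}

theorem ClosedPoint.isCoprime {p r : ClosedPoint a} (h : p ≠ r) : IsCoprime p.1 r.1 := by
  rw [p.2.2.1.coprime_iff_not_dvd]
  intro hd
  exact h (Subtype.ext (Polynomial.eq_of_monic_of_associated p.2.1 r.2.1
    (p.2.2.1.associated_of_dvd r.2.2.1 hd)))

open Classical in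
theorem kerCard_quotient_pow [Finite k] (p r : ClosedPoint a) (e j : ℕ) :
    kerCard (Polynomial k ⧸ Ideal.span {p.1 ^ e}) (r.1 ^ j) =
      Nat.card k ^ (if p = r then r.deg * min e j else 0) := by
  split_ifs with h
  · subst h
    have hp : p.1 ≠ 0 := p.2.2.1.ne_zero
    rcases le_total e j with he | he
    · rw [kerCard_of_dvd (pow_dvd_pow _ he), natCard_quotient_span (pow_ne_zero _ hp),
        Polynomial.natDegree_pow, min_eq_left he, mul_comm]
      rfl
    · obtain ⟨i, rfl⟩ := Nat.exists_eq_add_of_le' he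
      rw [pow_add, kerCard_mul (pow_ne_zero _ hp) (pow_ne_zero _ hp),
        natCard_quotient_span (pow_ne_zero _ hp), Polynomial.natDegree_pow, min_eq_right he,
        mul_comm]
      rfl
  · rw [kerCard_of_isCoprime (ClosedPoint.isCoprime h).pow, pow_zero]

/-- The direct product of the primary cyclic modules `k[X] / (p ^ e)`, for pairs `(p, e)` in a
family. -/
abbrev PrimaryProduct {ι : Type*} (c : ι → ClosedPoint a × ℕ+) : Type _ :=
  ∀ i, Polynomial k ⧸ Ideal.span {(c i).1.1 ^ ((c i).2 : ℕ)}

theorem natCard_primaryProduct [Finite k] {ι : Type*} [Fintype ι] (c : ι → ClosedPoint a × ℕ+) :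
    Nat.card (PrimaryProduct c) =
      Nat.card k ^ pairWeight ClosedPoint.deg (Finset.univ.val.map c) := by
  rw [Nat.card_pi, pairWeight, Multiset.map_map]
  change _ = Nat.card k ^ ∑ i, _
  rw [← Finset.prod_pow_eq_pow_sum]
  refine Finset.prod_congr rfl fun i _ => ?_
  rw [natCard_quotient_span (pow_ne_zero _ (c i).1.2.2.1.ne_zero), Polynomial.natDegree_pow]
  rfl

theorem kerCard_primaryProduct [Finite k] {ι : Type*} [Fintype ι] (c : ι → ClosedPoint a × ℕ+)
    (r : ClosedPoint a) (j : ℕ) :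
    kerCard (PrimaryProduct c) (r.1 ^ j) =
      Nat.card k ^ (r.deg * ((pairFiber r (Finset.univ.val.map c)).map fun e => min e j).sum) := by
  classical
  rw [kerCard_pi, Finset.prod_congr rfl fun i _ => kerCard_quotient_pow (c i).1 r _ j,
    Finset.prod_pow_eq_pow_sum]
  congr 1
  rw [pairFiber, Multiset.filter_map, Multiset.map_map, Multiset.map_map, ← Multiset.sum_map_mul_left,
    ← Finset.sum_filter, Finset.sum]
  simp [Function.comp_def]

/-- The second difference of j ↦ min(e, j) is -1 at e = j + 1 and 0 elsewhere, so the sums recover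
the multiplicities. -/
theorem count_eq_of_sum_min_eq {s t : Multiset ℕ}
    (h : ∀ j, (s.map fun e => min e j).sum = (t.map fun e => min e j).sum) (j : ℕ) :
    s.count (j + 1) = t.count (j + 1) := by
  have key : ∀ s : Multiset ℕ, 2 * (s.map fun e => min e (j + 1)).sum =
      (s.map fun e => min e j).sum + (s.map fun e => min e (j + 2)).sum + s.count (j + 1) := by
    intro s
    induction s using Multiset.induction with
    | empty => simp
    | cons e s ih =>
      simp only [Multiset.map_cons, Multiset.sum_cons, Multiset.count_cons]
      split_ifs with h <;> omega
  have h1 := key s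
  have h2 := key t
  rw [h, h, h] at h1
  omega

theorem eq_of_pairFiber_sum_min_eq {α : Type*} {m m' : Multiset (α × ℕ+)}
    (h : ∀ x j, ((pairFiber x m).map fun e => min e j).sum =
      ((pairFiber x m').map fun e => min e j).sum) : m = m' := by
  classical
  ext ⟨x, e⟩
  rw [← count_pairFiber, ← count_pairFiber, ← Nat.succ_pred_eq_of_pos e.pos]
  exact count_eq_of_sum_min_eq (h x) _

open Classical in
/-- A `k[X]`-module has primary type `m` if it is isomorphic to the direct product of the modules
`k[X] / (p ^ e)` for the pairs `(p, e)` in `m`. -/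
def HasPrimaryType {k : Type*} [Field k] {a : Polynomial k} (V : Type*) [AddCommGroup V]
    [Module (Polynomial k) V] (m : Multiset (ClosedPoint a × ℕ+)) : Prop :=
  Nonempty (V ≃ₗ[Polynomial k] PrimaryProduct fun i : m.ToType => i.1)

variable {V W : Type*} [AddCommGroup V] [Module (Polynomial k) V] [AddCommGroup W]
  [Module (Polynomial k) W]

theorem hasPrimaryType_of_equiv {ι : Type*} [Fintype ι] (c : ι → ClosedPoint a × ℕ+)
    (e : V ≃ₗ[Polynomial k] PrimaryProduct c) :
    HasPrimaryType V (Finset.univ.val.map c) := by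
  classical
  obtain ⟨σ, hσ⟩ := exists_equiv_comp_eq_of_map_univ_eq c
    (fun i : (Finset.univ.val.map c).ToType => i.1) (by rw [Multiset.map_univ_coe])
  refine ⟨e.trans (LinearEquiv.trans (LinearEquiv.piCongrRight fun i =>
    Submodule.quotEquivOfEq _ _ ?_) (LinearEquiv.piCongrLeft (Polynomial k)
      (fun i : (Finset.univ.val.map c).ToType =>
        Polynomial k ⧸ Ideal.span {i.1.1.1 ^ (i.1.2 : ℕ)}) σ))⟩
  rw [hσ]

theorem HasPrimaryType.of_equiv {m : Multiset (ClosedPoint a × ℕ+)} (h : HasPrimaryType V m)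
    (e : W ≃ₗ[Polynomial k] V) : HasPrimaryType W m :=
  ⟨e.trans h.some⟩

theorem HasPrimaryType.natCard_eq [Finite k] {m : Multiset (ClosedPoint a × ℕ+)}
    (h : HasPrimaryType V m) : Nat.card V = Nat.card k ^ pairWeight ClosedPoint.deg m := by
  classical
  rw [Nat.card_congr h.some.toEquiv, natCard_primaryProduct, Multiset.map_univ_coe]

/-- The kernel of r^j has q^(deg r · ∑ min(e, j)) elements, e running over the exponents paired with
r. These isomorphism invariants determine m. -/
theorem HasPrimaryType.unique [Finite k] {m m' : Multiset (ClosedPoint a × ℕ+)}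
    (h : HasPrimaryType V m) (h' : HasPrimaryType V m') : m = m' := by
  classical
  refine eq_of_pairFiber_sum_min_eq fun r j => ?_
  have h1 := h.some.kerCard_eq (r.1 ^ j)
  rw [h'.some.kerCard_eq, kerCard_primaryProduct, kerCard_primaryProduct, Multiset.map_univ_coe,
    Multiset.map_univ_coe] at h1
  exact (Nat.eq_of_mul_eq_mul_left r.deg_pos
    (Nat.pow_right_injective (Finite.one_lt_card (α := k)) h1)).symm

theorem HasPrimaryType.injective_smul {m : Multiset (ClosedPoint a × ℕ+)}
    (h : HasPrimaryType V m) (v : V) (hv : a • v = 0) : v = 0 := by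
  classical
  rw [← h.some.map_eq_zero_iff]
  have h1 : a • h.some v = 0 := by rw [← map_smul, hv, map_zero]
  funext i
  have h2 := congrFun h1 i
  have h3 := kerCard_of_isCoprime (f := i.1.1.1 ^ (i.1.2 : ℕ)) (g := a) i.1.1.2.2.2.pow_left
  rw [kerCard, Nat.card_eq_one_iff_unique] at h3
  have := h3.1
  exact congrArg Subtype.val (Subsingleton.elim
    (⟨h.some v i, h2⟩ : {v : Polynomial k ⧸ Ideal.span {i.1.1.1 ^ (i.1.2 : ℕ)} // a • v = 0})
    ⟨0, smul_zero _⟩)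

/-- Pigeonhole: k[X] is infinite, so two distinct polynomials agree on x and their difference kills
it. -/
theorem isTorsion_polynomial_of_finite [Finite V] : Module.IsTorsion (Polynomial k) V := by
  intro x
  obtain ⟨f, g, hne, hfg⟩ := Finite.exists_ne_map_eq_of_infinite fun f : Polynomial k => f • x
  refine ⟨⟨f - g, mem_nonZeroDivisors_of_ne_zero (sub_ne_zero.2 hne)⟩, ?_⟩
  change (f - g) • x = 0
  rw [sub_smul, sub_eq_zero]
  exact hfg

/-- If p divided a, then a would kill the nonzero class of p^(e-1). -/
theorem not_dvd_of_injective_smul {p : Polynomial k} (hp : Irreducible p) {e : ℕ} (he : e ≠ 0)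
    (ha : ∀ v : Polynomial k ⧸ Ideal.span {p ^ e}, a • v = 0 → v = 0) : ¬ p ∣ a := by
  obtain ⟨e, rfl⟩ := Nat.exists_eq_succ_of_ne_zero he
  intro h
  have h1 := ha (Ideal.Quotient.mk _ (p ^ e)) (by
    change Ideal.Quotient.mk _ (a * p ^ e) = 0
    rw [Ideal.Quotient.eq_zero_iff_mem, Ideal.mem_span_singleton, Nat.succ_eq_add_one, pow_succ']
    exact mul_dvd_mul_right h _)
  rw [Ideal.Quotient.eq_zero_iff_mem, Ideal.mem_span_singleton,
    pow_dvd_pow_iff hp.ne_zero hp.not_isUnit] at h1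
  omega

theorem exists_hasPrimaryType [Finite V] (ha : ∀ v : V, a • v = 0 → v = 0) :
    ∃ m : Multiset (ClosedPoint a × ℕ+), HasPrimaryType V m := by
  classical
  have : Module.Finite (Polynomial k) V := Module.Finite.of_finite
  obtain ⟨ι, _, p, hp, e, ⟨E⟩⟩ := Module.equiv_directSum_of_isTorsion
    (isTorsion_polynomial_of_finite (k := k) (V := V))
  let E' : V ≃ₗ[Polynomial k] ∀ i, Polynomial k ⧸ Ideal.span {p i ^ e i} :=
    E.trans (DirectSum.linearEquivFunOnFintype _ _ _)
  have hinj : ∀ i (v : Polynomial k ⧸ Ideal.span {p i ^ e i}), a • v = 0 → v = 0 := by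
    intro i v hv
    have h1 : E'.symm (Pi.single i v) = 0 := by
      apply ha
      rw [← map_smul, ← Pi.single_smul, hv, Pi.single_zero, map_zero]
    rw [E'.symm.map_eq_zero_iff] at h1
    simpa using congrFun h1 i
  -- The structure theorem allows zero exponents and non-monic p i: the former give trivial factors,
  -- dropped by ρ, and the latter are normalized without changing the ideals.
  let c : {i // e i ≠ 0} → ClosedPoint a × ℕ+ := fun i =>
    (⟨normalize (p i), Polynomial.monic_normalize (hp i).ne_zero,
      (associated_normalize (p i)).irreducible (hp i), by
        have h := (hp i.1).coprime_iff_not_dvd.2 (not_dvd_of_injective_smul (hp i) i.2 (hinj i))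
        exact h.of_isCoprime_of_dvd_left (normalize_associated (p i)).dvd⟩,
      ⟨e i, Nat.pos_of_ne_zero i.2⟩)
  let ρ : (∀ i, Polynomial k ⧸ Ideal.span {p i ^ e i}) →ₗ[Polynomial k]
      ∀ i : {i // e i ≠ 0}, Polynomial k ⧸ Ideal.span {p i ^ e i} :=
    LinearMap.pi fun i => LinearMap.proj i.1
  have hρ : Function.Bijective ρ := by
    constructor
    · intro v w h
      funext i
      by_cases hi : e i = 0
      · have : Subsingleton (Polynomial k ⧸ Ideal.span {p i ^ e i}) := by
          rw [Ideal.Quotient.subsingleton_iff, Ideal.span_singleton_eq_top, hi, pow_zero]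
          exact isUnit_one
        exact Subsingleton.elim _ _
      · exact congrFun h ⟨i, hi⟩
    · intro v
      refine ⟨fun i => if h : e i ≠ 0 then v ⟨i, h⟩ else 0, ?_⟩
      funext i
      exact dif_pos i.2
  refine ⟨_, hasPrimaryType_of_equiv c (E'.trans ((LinearEquiv.ofBijective ρ hρ).trans
    (LinearEquiv.piCongrRight fun i => Submodule.quotEquivOfEq _ _ ?_)))⟩
  rw [Ideal.span_singleton_eq_span_singleton]
  exact (associated_normalize (p i)).pow_pow
end

/-! ### Conjugacy classes of matrices -/

theorem natCard_conjClasses_eq {G T : Type*} [Monoid G] (r : G → T → Prop)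
    (h1 : ∀ g, ∃ t, r g t) (h2 : ∀ t, ∃ g, r g t)
    (h3 : ∀ g g' t t', r g t → r g' t' → (IsConj g g' ↔ t = t')) :
    Nat.card (ConjClasses G) = Nat.card T := by
  choose f hf using h1
  refine Nat.card_eq_of_bijective (Quotient.lift f fun g g' h =>
    (h3 g g' _ _ (hf g) (hf g')).1 h) ⟨?_, ?_⟩
  · intro x y
    induction x using Quotient.inductionOn with | _ g =>
    induction y using Quotient.inductionOn with | _ g' =>
    intro h
    exact Quotient.sound ((h3 g g' _ _ (hf g) (hf g')).2 h)
  · intro t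
    obtain ⟨g, hg⟩ := h2 t
    exact ⟨ConjClasses.mk g, (h3 g g _ _ (hf g) hg).1 (IsConj.refl g)⟩

section
variable {k : Type*} [Field k] {n : ℕ}

/-- The `k[X]`-module `k ^ n` on which `X` acts as the matrix `A`. -/
abbrev MatrixModule (A : Matrix (Fin n) (Fin n) k) : Type _ :=
  Module.AEval' (Matrix.toLin' A)

theorem MatrixModule.X_smul_of (A : Matrix (Fin n) (Fin n) k) (v : Fin n → k) :
    (Polynomial.X : Polynomial k) • (Module.AEval'.of (Matrix.toLin' A) v) =
      Module.AEval'.of (Matrix.toLin' A) (A.mulVec v) := by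
  rw [Module.AEval'.X_smul_of, Matrix.toLin'_apply]

/-- A k[X]-isomorphism is a k-linear automorphism of k^n commuting with the action of X, i.e. an
invertible c with cA = Bc. -/
theorem isConj_iff_nonempty_linearEquiv (A B : Matrix (Fin n) (Fin n) k) :
    IsConj A B ↔ Nonempty (MatrixModule A ≃ₗ[Polynomial k] MatrixModule B) := by
  constructor
  · rintro ⟨c, hc⟩
    let f : (Fin n → k) ≃ₗ[k] (Fin n → k) :=
      LinearEquiv.ofLinearMap (Matrix.toLin' c.1) (Matrix.toLin' c.2)
        (by rw [← Matrix.toLin'_mul, c.3, Matrix.toLin'_one])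
        (by rw [← Matrix.toLin'_mul, c.4, Matrix.toLin'_one])
    have hf : ∀ v, f v = (c : Matrix (Fin n) (Fin n) k).mulVec v := fun v => rfl
    refine ⟨LinearEquiv.ofAEval _ (f.trans (Module.AEval'.of (Matrix.toLin' B))) fun v => ?_⟩
    rw [LinearEquiv.trans_apply, LinearEquiv.trans_apply, MatrixModule.X_smul_of, hf, hf,
      Module.End.smul_def, Matrix.toLin'_apply, Matrix.mulVec_mulVec, Matrix.mulVec_mulVec, hc.eq]
  · rintro ⟨e⟩
    let f : (Fin n → k) ≃ₗ[k] (Fin n → k) := (Module.AEval'.of (Matrix.toLin' A)).trans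
      ((e.restrictScalars k).trans (Module.AEval'.of (Matrix.toLin' B)).symm)
    have hf : ∀ v, f (A.mulVec v) = B.mulVec (f v) := by
      intro v
      apply (Module.AEval'.of (Matrix.toLin' B)).injective
      rw [← MatrixModule.X_smul_of]
      simp only [f, LinearEquiv.trans_apply, LinearEquiv.apply_symm_apply]
      rw [← MatrixModule.X_smul_of]
      exact e.map_smul _ _
    refine ⟨⟨LinearMap.toMatrix' f.toLinearMap, LinearMap.toMatrix' f.symm.toLinearMap, ?_, ?_⟩, ?_⟩
    · rw [← LinearMap.toMatrix'_comp]; simp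
    · rw [← LinearMap.toMatrix'_comp]; simp
    · change LinearMap.toMatrix' f.toLinearMap * A = B * LinearMap.toMatrix' f.toLinearMap
      apply Matrix.toLin'.injective
      rw [Matrix.toLin'_mul, Matrix.toLin'_mul, Matrix.toLin'_toMatrix']
      refine LinearMap.ext fun v => ?_
      simp only [LinearMap.comp_apply, Matrix.toLin'_apply, LinearEquiv.coe_coe, hf]

/-- The cardinality forces dimension n; A is the action of X in a basis. -/
theorem exists_matrixModule_equiv [Finite k] {V : Type*} [AddCommGroup V] [Module k V]
    [Module (Polynomial k) V] [IsScalarTower k (Polynomial k) V] (hV : Nat.card V = Nat.card k ^ n) :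
    ∃ A : Matrix (Fin n) (Fin n) k, Nonempty (MatrixModule A ≃ₗ[Polynomial k] V) := by
  have hk := Finite.one_lt_card (α := k)
  have : Finite V := Nat.finite_of_card_ne_zero (by rw [hV]; positivity)
  have : Module.Finite k V := Module.Finite.of_finite
  have hr : Module.finrank k V = n := by
    rw [Module.natCard_eq_pow_finrank (K := k)] at hV
    exact Nat.pow_right_injective hk hV
  let e : (Fin n → k) ≃ₗ[k] V := (LinearEquiv.ofFinrankEq V (Fin n → k) (by simp [hr])).symm
  let φ : (Fin n → k) →ₗ[k] (Fin n → k) :=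
    e.symm.toLinearMap ∘ₗ (Module.toModuleEnd k V (S := Polynomial k) Polynomial.X) ∘ₗ e.toLinearMap
  refine ⟨LinearMap.toMatrix' φ, ⟨LinearEquiv.ofAEval _ e fun v => ?_⟩⟩
  rw [Matrix.toLin'_toMatrix']
  simp [φ]

theorem exists_matrixModule_hasPrimaryType [Finite k] {a : Polynomial k}
    (m : Multiset (ClosedPoint a × ℕ+)) (hm : pairWeight ClosedPoint.deg m = n) :
    ∃ A : Matrix (Fin n) (Fin n) k, HasPrimaryType (MatrixModule A) m := by
  classical
  have h : HasPrimaryType (PrimaryProduct fun i : m.ToType => i.1) m := ⟨LinearEquiv.refl _ _⟩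
  obtain ⟨A, ⟨e⟩⟩ := exists_matrixModule_equiv (n := n) (h.natCard_eq.trans (by rw [hm]))
  exact ⟨A, h.of_equiv e⟩

theorem natCard_matrixModule (A : Matrix (Fin n) (Fin n) k) :
    Nat.card (MatrixModule A) = Nat.card k ^ n := by
  rw [← Nat.card_congr (Module.AEval'.of (Matrix.toLin' A)).toEquiv, Nat.card_fun, Nat.card_fin]

theorem exists_matrixModule_type [Finite k] {a : Polynomial k} (A : Matrix (Fin n) (Fin n) k)
    (ha : ∀ v : MatrixModule A, a • v = 0 → v = 0) :
    ∃ m : {m : Multiset (ClosedPoint a × ℕ+) // pairWeight ClosedPoint.deg m = n},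
      HasPrimaryType (MatrixModule A) m.1 := by
  have : Finite (MatrixModule A) := Finite.of_equiv _ (Module.AEval'.of (Matrix.toLin' A)).toEquiv
  obtain ⟨m, hm⟩ := exists_hasPrimaryType ha
  refine ⟨⟨m, ?_⟩, hm⟩
  have h := hm.natCard_eq
  rw [natCard_matrixModule] at h
  exact (Nat.pow_right_injective (Finite.one_lt_card (α := k)) h).symm

theorem isConj_iff_primaryType_eq [Finite k] {a : Polynomial k} {A B : Matrix (Fin n) (Fin n) k}
    {m m' : Multiset (ClosedPoint a × ℕ+)} (hA : HasPrimaryType (MatrixModule A) m)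
    (hB : HasPrimaryType (MatrixModule B) m') : IsConj A B ↔ m = m' := by
  rw [isConj_iff_nonempty_linearEquiv]
  constructor
  · rintro ⟨e⟩
    exact hA.unique (hB.of_equiv e)
  · rintro rfl
    exact ⟨hA.some.trans hB.some.symm⟩

/-- X acts as A, so this is injectivity of A. It is why a = X singles out the general linear group.
-/
theorem isUnit_iff_X_smul_injective (A : Matrix (Fin n) (Fin n) k) :
    IsUnit A ↔ ∀ v : MatrixModule A, (Polynomial.X : Polynomial k) • v = 0 → v = 0 := by
  rw [← Matrix.mulVec_injective_iff_isUnit]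
  constructor
  · intro h v
    obtain ⟨v, rfl⟩ := (Module.AEval'.of (Matrix.toLin' A)).surjective v
    rw [MatrixModule.X_smul_of, LinearEquiv.map_eq_zero_iff, LinearEquiv.map_eq_zero_iff]
    intro hv
    exact h (hv.trans (Matrix.mulVec_zero A).symm)
  · intro h v w hvw
    rw [← sub_eq_zero, ← Matrix.mulVec_sub] at hvw
    have := h (Module.AEval'.of (Matrix.toLin' A) (v - w)) (by
      rw [MatrixModule.X_smul_of, hvw, map_zero])
    rwa [LinearEquiv.map_eq_zero_iff, sub_eq_zero] at this

theorem natCard_conjClasses_matrix [Finite k] :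
    Nat.card (ConjClasses (Matrix (Fin n) (Fin n) k)) = pairCount (1 : Polynomial k) n :=
  natCard_conjClasses_eq (fun A m => HasPrimaryType (MatrixModule A) m.1)
    (fun A => exists_matrixModule_type A fun v hv => by rwa [one_smul] at hv)
    (fun m => exists_matrixModule_hasPrimaryType m.1 m.2)
    fun _ _ _ _ h h' => (isConj_iff_primaryType_eq h h').trans Subtype.ext_iff.symm

theorem GeneralLinearGroup.isConj_iff_val (g g' : Matrix.GeneralLinearGroup (Fin n) k) :
    IsConj g g' ↔ IsConj (g : Matrix (Fin n) (Fin n) k) g' := by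
  rw [isConj_iff]
  refine exists_congr fun c => ?_
  rw [SemiconjBy, mul_inv_eq_iff_eq_mul, Units.ext_iff]
  rfl

theorem natCard_conjClasses_generalLinearGroup [Finite k] :
    Nat.card (ConjClasses (Matrix.GeneralLinearGroup (Fin n) k)) =
      pairCount (Polynomial.X : Polynomial k) n := by
  refine natCard_conjClasses_eq (fun g m => HasPrimaryType (MatrixModule g.1) m.1)
    (fun g => exists_matrixModule_type g.1 ((isUnit_iff_X_smul_injective g.1).1 g.isUnit))
    (fun m => ?_)
    fun g g' _ _ h h' => (GeneralLinearGroup.isConj_iff_val g g').trans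
      ((isConj_iff_primaryType_eq h h').trans Subtype.ext_iff.symm)
  obtain ⟨A, hA⟩ := exists_matrixModule_hasPrimaryType m.1 m.2
  obtain ⟨u, rfl⟩ := (isUnit_iff_X_smul_injective A).2 hA.injective_smul
  exact ⟨u, hA⟩

theorem conjGenM_eq (k : Type*) [Field k] [Finite k] :
    conjGenM k = PowerSeries.mk fun n => (pairCount (1 : Polynomial k) n : ℤ) := by
  simp only [conjGenM, natCard_conjClasses_matrix]

theorem conjGenGL_eq (k : Type*) [Field k] [Finite k] :
    conjGenGL k = PowerSeries.mk fun n => (pairCount (Polynomial.X : Polynomial k) n : ℤ) := by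
  simp only [conjGenGL, natCard_conjClasses_generalLinearGroup]
end

theorem mainTheorem5 (k K : Type*) [Field k] [Finite k] [Field K] [Algebra k K]
    [IsAlgClosure k K] :
    (IsColoringZeta partitionColors (frobGm k K) (conjGenGL k) ∧
      HasProd
        (fun n : ℕ+ => (1 - (X : ℤ⟦X⟧) ^ (n : ℕ)) *
          seriesInv (1 - PowerSeries.C (Nat.card k : ℤ) * X ^ (n : ℕ)))
        (conjGenGL k)) ∧
    (IsColoringZeta partitionColors (frobGa k K) (conjGenM k) ∧
      HasProd
        (fun n : ℕ+ => seriesInv (1 - PowerSeries.C (Nat.card k : ℤ) * (X : ℤ⟦X⟧) ^ (n : ℕ)))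
        (conjGenM k)) := by
  rw [conjGenGL_eq, conjGenM_eq]
  exact ⟨⟨isColoringZeta_frobGm, hasProd_pairCount_X⟩, isColoringZeta_frobGa, hasProd_pairCount_one⟩
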